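/- All groups are finite. Let $p$ be a prime and let $P$ be a Sylow $p$-subgroup of a $p$-soluble group $G$ (that is, every chief factor of $G$ is either a $p$-group or a group of order not divisible by $p$). For a finite group $X$ let $\pi(X)$ be the set of primes dividing $|X|$; for a set $\pi$ of primes, a $\pi$-number is a positive integer all of whose prime divisors lie in $\pi$. A subgroup $H$ of $G$ satisfies the partial $\Pi$-property in $G$ if there is a chief series $1=G_0<G_1<\cdots<G_n=G$ of $G$ such that, for every $1\le i\le n$, the index $$\bigl|G/G_{i-1}:N_{G/G_{i-1}}\bigl(HG_{i-1}/G_{i-1}\cap G_i/G_{i-1}\bigr)\bigr|$$ is a $\pi\bigl(HG_{i-1}/G_{i-1}\cap G_i/G_{i-1}\bigr)$-number. A subgroup $H$ of $P$ is called $2$-minimal in $P$ if it has a maximal subgroup that is a minimal (nontrivial) subgroup of $P$; as $P$ is a $p$-group, this means $|H|=p^2$. Assume that every $2$-minimal subgroup of $P$ satisfies the partial $\Pi$-property in $G$. Then the $p$-length of $G$ is at most $1$. Here the $p$-length of a $p$-soluble group $G$ is the least $l\ge 0$ with $N_l=G$ in the upper $p$-series $1\le N_0\le P_1\le N_1\le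 P_2\le N_2\le\cdots$ of $G$, defined by $N_0=O_{p'}(G)$, $P_{j+1}/N_j=O_p(G/N_j)$ and $N_{j+1}/P_{j+1}=O_{p'}(G/P_{j+1})$. -/

import Mathlib

/-- `n` is a `π`-number: every prime divisor of `n` belongs to `π`. -/
def IsPiNumber (π : Set ℕ) (n : ℕ) : Prop :=
  ∀ q : ℕ, q.Prime → q ∣ n → q ∈ π

/-- `π(G)`, the set of primes dividing the order of the (finite) group `G`. -/
def groupPrimes (G : Type*) [Group G] : Set ℕ :=
  {q | q.Prime ∧ q ∣ Nat.card G}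

/-- `L / K` is a chief factor of `G`: `K < L` are normal subgroups of `G` and no normal
subgroup of `G` lies strictly between them. -/
structure IsChiefFactor {G : Type*} [Group G] (K L : Subgroup G) : Prop where
  normal_bot : K.Normal
  normal_top : L.Normal
  lt : K < L
  eq_or_eq : ∀ N : Subgroup G, N.Normal → K ≤ N → N ≤ L → N = K ∨ N = L

/-- The subgroup `H A / A ∩ B / A` of `G / A`. -/
def factorTrace {G : Type*} [Group G] (H A B : Subgroup G) [A.Normal] : Subgroup (G ⧸ A) :=
  (H ⊔ A).map (QuotientGroup.mk' A) ⊓ B.map (QuotientGroup.mk' A)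

/-- The partial `Π`-property of `H` in the finite group `G`: there is a chief series
`1 = G₀ < G₁ < ⋯ < Gₙ = G` such that, for every `i`, with `X = H Gᵢ₋₁ / Gᵢ₋₁ ∩ Gᵢ / Gᵢ₋₁`,
the index of the normalizer of `X` in `G / Gᵢ₋₁` is a `π(X)`-number. -/
def PartialPiProperty {G : Type*} [Group G] (H : Subgroup G) : Prop :=
  ∃ s : RelSeries {(K, L) : Subgroup G × Subgroup G | IsChiefFactor K L},
    s.head = ⊥ ∧ s.last = ⊤ ∧
      ∀ i : Fin s.length,
        haveI : (s i.castSucc).Normal := IsChiefFactor.normal_bot (s.step i)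
        IsPiNumber (groupPrimes (factorTrace H (s i.castSucc) (s i.succ)))
          (Subgroup.normalizer
            (factorTrace H (s i.castSucc) (s i.succ) : Set (G ⧸ s i.castSucc))).index

/-- `H` is a 2-minimal (second minimal) subgroup of `P`: a subgroup of `P` in which some minimal
subgroup is maximal, i.e. `1 < K < H` with both inclusions proper and nothing in between. -/
def IsTwoMinimalIn {G : Type*} [Group G] (P H : Subgroup G) : Prop :=
  H ≤ P ∧ ∃ K : Subgroup G, ⊥ ⋖ K ∧ K ⋖ H

/-- `G` (finite) is `p`-soluble: the order of each chief factor of `G` is a power of `p` or is not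
divisible by `p`. -/
def IsPSoluble (p : ℕ) (G : Type*) [Group G] : Prop :=
  ∀ K L : Subgroup G, IsChiefFactor K L →
    IsPiNumber {p} (K.relIndex L) ∨ IsPiNumber {p}ᶜ (K.relIndex L)

/-- `O_π(G)`: the subgroup generated by all normal `π`-subgroups of the finite group `G`,
which is its largest normal `π`-subgroup. -/
def piCore (π : Set ℕ) (G : Type*) [Group G] : Subgroup G :=
  sSup {N | N.Normal ∧ IsPiNumber π (Nat.card N)}

theorem piCore_normal (π : Set ℕ) (G : Type*) [Group G] : (piCore π G).Normal :=
  Subgroup.sSup_normal _ fun _ hN => hN.1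

/-- The subgroup `M` of `G` containing `N` with `M / N = O_π(G / N)`. -/
def piCoreAbove {G : Type*} [Group G] (π : Set ℕ) (N : {N : Subgroup G // N.Normal}) :
    {M : Subgroup G // M.Normal} :=
  haveI := N.2
  ⟨(piCore π (G ⧸ N.1)).comap (QuotientGroup.mk' N.1),
    (piCore_normal π (G ⧸ N.1)).comap (QuotientGroup.mk' N.1)⟩

/-- The terms `N₀ ≤ N₁ ≤ ⋯` of the upper `p`-series `1 ≤ N₀ ≤ P₁ ≤ N₁ ≤ P₂ ≤ N₂ ≤ ⋯` of `G`, where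
`N₀ = O_{p'}(G)`, `Pₗ₊₁ / Nₗ = O_p(G / Nₗ)` and `Nₗ / Pₗ = O_{p'}(G / Pₗ)`. -/
def upperPSeries (p : ℕ) (G : Type*) [Group G] : ℕ → {N : Subgroup G // N.Normal}
  | 0 => ⟨piCore {p}ᶜ G, piCore_normal {p}ᶜ G⟩
  | l + 1 => piCoreAbove {p}ᶜ (piCoreAbove {p} (upperPSeries p G l))

/-- The `p`-length of the finite group `G`: the least `l` such that the term `Nₗ` of the upper
`p`-series is `G`. It is `⊤` when there is no such `l`, i.e. when `G` is not `p`-soluble. -/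
noncomputable def pLength (p : ℕ) (G : Type*) [Group G] : ℕ∞ :=
  ⨅ (l : ℕ) (_ : (upperPSeries p G l).1 = ⊤), (l : ℕ∞)

/-! Put N = O_{p'}(G). The p-length is at most 1 once the Sylow p-subgroup of G/N is normal. Only a
consequence of the hypothesis is carried over to G/N, namely `HasPowIndexTraces`: for A with largest
proper G-invariant subgroup B, some factor of the chief series covers A/B modulo N, and the trace of
H = ⟨k, y⟩ there is a p-group, so its normaliser has p-power index. If P also normalises the trace,
that index is prime to p as well, and the trace is normal in G. Traces are therefore tested on
subgroups generated by elements that P nearly centralises.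

Now let O_{p'}(G) = 1 and suppose that P is not normal. By Hall–Higman
(`IsPSoluble.centralizer_normalCore_le`), O_p(G) contains its centraliser, and a critical-subgroup
argument (`exists_critical_normal_subgroup`) yields a chief factor A/B below O_p(G) on which P acts
non-trivially. Suitable choices of H then force B = 1 (`eq_bot_of_hasPowIndexTraces`), and |A| = p²
with Z = C_A(P) of order p (`exists_generators_of_hasPowIndexTraces`).

In `Sylow.normal_of_hasPowIndexTraces`, a further choice puts all elements of order p of Z(P) into
Z, so A is the unique minimal normal subgroup. Finally, some H of order p² satisfies H ∩ A = Z,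
which makes Z normal and contradicts the minimality of A. -/

/-! ### Powers, commutators and Sylow subgroups -/

theorem exists_pow_notMem_pow_mem {G : Type*} [Group G] {p : ℕ} {X : Subgroup G} {y : G}
    (hy : y ∉ X) {n : ℕ} (hn : y ^ p ^ n ∈ X) : ∃ m : ℕ, y ^ m ∉ X ∧ (y ^ m) ^ p ∈ X := by
  classical
  have hex : ∃ n : ℕ, y ^ p ^ n ∈ X := ⟨n, hn⟩
  have h0 : Nat.find hex ≠ 0 := fun h => hy (by simpa [h] using Nat.find_spec hex)
  obtain ⟨j, hj⟩ := Nat.exists_eq_succ_of_ne_zero h0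
  refine ⟨p ^ j, Nat.find_min hex (by omega), ?_⟩
  have := Nat.find_spec hex
  rwa [hj, pow_succ, pow_mul] at this

/-- Moving each x to the left past a power of y costs central factors c. The exponent is n(n-1)/2,
but only its existence is needed, because c lies in a subgroup that absorbs its powers. -/
theorem mul_pow_of_commute_commutator {G : Type*} [Group G] {x y c : G} (h : y * x = c * x * y)
    (hx : Commute c x) (hy : Commute c y) (n : ℕ) :
    ∃ k : ℕ, (x * y) ^ n = x ^ n * y ^ n * c ^ k := by
  have hyn : ∀ n : ℕ, y ^ n * x = c ^ n * x * y ^ n := by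
    intro n
    induction n with
    | zero => simp
    | succ n ih =>
      calc y ^ (n + 1) * x = y * (y ^ n * x) := by rw [pow_succ']; group
        _ = y * c ^ n * x * y ^ n := by rw [ih]; group
        _ = c ^ n * (y * x) * y ^ n := by rw [← (hy.pow_left n).eq]; group
        _ = c ^ n * c * x * (y * y ^ n) := by rw [h]; group
        _ = _ := by rw [← pow_succ, ← pow_succ']
  induction n with
  | zero => exact ⟨0, by simp⟩
  | succ n ih =>
    obtain ⟨k, hk⟩ := ih
    refine ⟨k + n, ?_⟩
    have hck : Commute (c ^ k) (x * y) := (hx.mul_right hy).pow_left k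
    have hcn : Commute (c ^ n) (x * (y ^ n * y)) :=
      (hx.mul_right ((hy.pow_right n).mul_right hy)).pow_left n
    calc (x * y) ^ (n + 1) = x ^ n * y ^ n * (c ^ k * (x * y)) := by rw [pow_succ, hk]; group
      _ = x ^ n * (y ^ n * x) * y * c ^ k := by rw [hck.eq]; group
      _ = x ^ n * (c ^ n * (x * (y ^ n * y))) * c ^ k := by rw [hyn]; group
      _ = x ^ n * x * (y ^ n * y) * (c ^ k * c ^ n) := by
        rw [hcn.eq, (Commute.pow_pow (Commute.refl c) k n).eq]; group
      _ = _ := by rw [← pow_succ, ← pow_succ, ← pow_add]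

/-- Take W minimal among the normal subgroups inside Y and not inside X. If ⁅Q, W⁆ were not inside X
it would equal W, against nilpotency. So every element of W is central modulo X, and a power of one
outside X does the job. -/
theorem IsPGroup.exists_notMem_commutator_mem {Q : Type*} [Group Q] [Finite Q] {p : ℕ}
    [Fact p.Prime] (hQ : IsPGroup p Q) {X Y : Subgroup Q} [X.Normal] [Y.Normal] (h : ¬ Y ≤ X) :
    ∃ y ∈ Y, y ∉ X ∧ y ^ p ∈ X ∧ ∀ x : Q, x * y * x⁻¹ * y⁻¹ ∈ X := by
  obtain ⟨W, ⟨hWn, hWY, hWX⟩, hmin⟩ :=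
    (Set.toFinite {W : Subgroup Q | W.Normal ∧ W ≤ Y ∧ ¬ W ≤ X}).exists_minimal
      ⟨Y, inferInstance, le_rfl, h⟩
  have hcX : ⁅(⊤ : Subgroup Q), W⁆ ≤ X := by
    by_contra hc
    have hle : ⁅(⊤ : Subgroup Q), W⁆ ≤ W := Subgroup.commutator_le_right _ _
    have hWle : W ≤ ⁅(⊤ : Subgroup Q), W⁆ := hmin ⟨inferInstance, hle.trans hWY, hc⟩ hle
    have htop : Group.IsNilpotent (⊤ : Subgroup Q) := (hQ.to_subgroup ⊤).isNilpotent
    obtain ⟨n, hn⟩ := (⊤ : Subgroup Q).isNilpotent_iff_lowerCentralSeries.mp htop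
    have hl : ∀ n, W ≤ (⊤ : Subgroup Q).lowerCentralSeries n := by
      intro n
      induction n with
      | zero => simp
      | succ n ih =>
        refine hWle.trans ?_
        rw [Subgroup.commutator_comm]
        exact Subgroup.commutator_mono ih le_rfl
    exact hWX ((hl n).trans (hn ▸ bot_le))
  obtain ⟨w, hwW, hwX⟩ := SetLike.not_le_iff_exists.mp hWX
  obtain ⟨n, hn⟩ := isPGroup_iff_pow_pow_eq_one.mp hQ w
  obtain ⟨m, hm, hmp⟩ := exists_pow_notMem_pow_mem hwX (p := p) (n := n) (by rw [hn]; exact X.one_mem)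
  exact ⟨w ^ m, hWY (pow_mem hwW m), hm, hmp, fun x =>
    hcX (Subgroup.commutator_mem_commutator (Subgroup.mem_top x) (pow_mem hwW m))⟩

/-- This is the source of all elements of P used to build second minimal subgroups. X and Y need
only be P-invariant, and X need not lie in P. -/
theorem IsPGroup.exists_notMem_commutator_mem_of_le {G : Type*} [Group G] [Finite G] {p : ℕ}
    [Fact p.Prime] {P X Y : Subgroup G} (hP : IsPGroup p P) (hY : Y ≤ P)
    (hXn : ∀ x ∈ P, ∀ a ∈ X, x * a * x⁻¹ ∈ X) (hYn : ∀ x ∈ P, ∀ a ∈ Y, x * a * x⁻¹ ∈ Y)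
    (h : ¬ Y ≤ X) : ∃ y ∈ Y, y ∉ X ∧ y ^ p ∈ X ∧ ∀ x ∈ P, x * y * x⁻¹ * y⁻¹ ∈ X := by
  have h1 : (X.subgroupOf P).Normal := ⟨fun a ha x => hXn x x.2 a ha⟩
  have h2 : (Y.subgroupOf P).Normal := ⟨fun a ha x => hYn x x.2 a ha⟩
  have h3 : ¬ Y.subgroupOf P ≤ X.subgroupOf P := fun hle => h fun a ha =>
    hle (show (⟨a, hY ha⟩ : P) ∈ Y.subgroupOf P from ha)
  obtain ⟨y, hyY, hyX, hyp, hyc⟩ := hP.exists_notMem_commutator_mem h3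
  exact ⟨y, hyY, hyX, hyp, fun x hx => hyc ⟨x, hx⟩⟩

/-- A subgroup normalised by a Sylow `p`-subgroup, the index of whose normaliser is a power of `p`,
is normal. -/
theorem Subgroup.normal_of_isPiNumber_index_normalizer {G : Type*} [Group G] [Finite G] {p : ℕ}
    [Fact p.Prime] (P : Sylow p G) {T : Subgroup G}
    (hT : IsPiNumber {p} (Subgroup.normalizer (T : Set G)).index)
    (hPT : ∀ x ∈ P, ∀ a ∈ T, x * a * x⁻¹ ∈ T) : T.Normal := by
  rw [← Subgroup.normalizer_eq_top_iff, ← Subgroup.index_eq_one]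
  have hle : (P : Subgroup G) ≤ Subgroup.normalizer (T : Set G) := by
    intro x hx
    rw [Subgroup.mem_normalizer_iff]
    refine fun a => ⟨hPT x hx a, fun ha => ?_⟩
    have := hPT x⁻¹ (inv_mem hx) _ ha
    simpa [mul_assoc] using this
  by_contra hne
  obtain ⟨q, hq, hqd⟩ := Nat.exists_prime_and_dvd hne
  have hqp : q = p := hT q hq hqd
  subst hqp
  exact P.not_dvd_index (hqd.trans (Subgroup.index_dvd_of_le hle))

theorem orderOf_eq_prime_of_mem {G : Type*} [Group G] [Finite G] {p : ℕ} [Fact p.Prime]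
    {M : Subgroup G} (hM : p ∣ Nat.card M) : ∃ g ∈ M, orderOf g = p := by
  obtain ⟨g, hg⟩ := exists_prime_orderOf_dvd_card' (G := M) p hM
  exact ⟨g, g.2, by rw [← hg, Subgroup.orderOf_coe]⟩

theorem exists_eq_zpow_mul_zpow_of_mem_sup {G : Type*} [Group G] {k y j : G} (hky : Commute k y)
    (hj : j ∈ Subgroup.zpowers k ⊔ Subgroup.zpowers y) : ∃ i n : ℤ, j = k ^ i * y ^ n := by
  let S : Subgroup G :=
    { carrier := {j | ∃ i n : ℤ, j = k ^ i * y ^ n}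
      one_mem' := ⟨0, 0, by simp⟩
      mul_mem' := by
        rintro _ _ ⟨i, n, rfl⟩ ⟨i', n', rfl⟩
        refine ⟨i + i', n + n', ?_⟩
        rw [zpow_add, zpow_add, mul_assoc, mul_assoc, ← mul_assoc (y ^ n),
          ← (hky.zpow_zpow i' n).eq, mul_assoc]
      inv_mem' := by
        rintro _ ⟨i, n, rfl⟩
        refine ⟨-i, -n, ?_⟩
        rw [mul_inv_rev, ← zpow_neg, ← zpow_neg, (hky.zpow_zpow (-i) (-n)).eq] }
  have hS : Subgroup.zpowers k ⊔ Subgroup.zpowers y ≤ S := by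
    rw [sup_le_iff, Subgroup.zpowers_le, Subgroup.zpowers_le]
    exact ⟨⟨1, 0, by simp⟩, ⟨0, 1, by simp⟩⟩
  exact hS hj

/-- If `y ^ p ∈ K` then every subgroup between `K` and `⟨K, y⟩`, where `y` commutes with `K`,
is one of the two. -/
theorem eq_or_eq_of_le_sup_zpowers {G : Type*} [Group G] {p : ℕ} [hp : Fact p.Prime] {k y : G}
    (hky : Commute k y) (hyp : y ^ p ∈ Subgroup.zpowers k) {J : Subgroup G}
    (hkJ : Subgroup.zpowers k ≤ J) (hJ : J ≤ Subgroup.zpowers k ⊔ Subgroup.zpowers y) :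
    J = Subgroup.zpowers k ∨ J = Subgroup.zpowers k ⊔ Subgroup.zpowers y := by
  by_cases hle : J ≤ Subgroup.zpowers k
  · exact .inl (le_antisymm hle hkJ)
  · right
    refine le_antisymm hJ (sup_le hkJ ?_)
    rw [Subgroup.zpowers_le]
    obtain ⟨j, hjJ, hjk⟩ := SetLike.not_le_iff_exists.mp hle
    obtain ⟨i, n, rfl⟩ : ∃ i n : ℤ, j = k ^ i * y ^ n := exists_eq_zpow_mul_zpow_of_mem_sup hky (hJ hjJ)
    have hyn : y ^ n ∈ J := by
      have := mul_mem (inv_mem (hkJ (Subgroup.mem_zpowers_iff.mpr ⟨i, rfl⟩))) hjJ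
      simpa using this
    have hpn : ¬ (p : ℤ) ∣ n := by
      rintro ⟨m, rfl⟩
      refine hjk (mul_mem (Subgroup.mem_zpowers_iff.mpr ⟨i, rfl⟩) ?_)
      rw [zpow_mul, zpow_natCast]
      exact zpow_mem hyp m
    have hcop : IsCoprime (p : ℤ) n :=
      (Prime.coprime_iff_not_dvd (Nat.prime_iff_prime_int.mp hp.out)).mpr hpn
    obtain ⟨u, v, huv⟩ := hcop
    have : y = (y ^ p) ^ u * (y ^ n) ^ v := by
      rw [← zpow_natCast, ← zpow_mul, ← zpow_mul, ← zpow_add, mul_comm (p : ℤ), mul_comm n, huv,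
        zpow_one]
    rw [this]
    exact mul_mem (zpow_mem (hkJ hyp) u) (zpow_mem hyn v)

/-! ### Coprime action and the critical subgroup -/

theorem eq_one_of_isPGroup_of_coprime {G : Type*} [Group G] {p : ℕ} {H : Subgroup G}
    (hH : IsPGroup p H) {g : G} (hg : g ∈ H) {n : ℕ} (hn : p.Coprime n) (hgn : g ^ n = 1) :
    g = 1 := by
  have h := hH.orderOf_coprime hn ⟨g, hg⟩
  rw [← orderOf_eq_one_iff, ← Subgroup.orderOf_mk g hg]
  refine Nat.eq_one_of_dvd_coprimes h dvd_rfl ?_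
  rw [Subgroup.orderOf_mk]
  exact orderOf_dvd_of_pow_eq_one hgn

/-- An element of order prime to `p` that centralises `⁅A, L⁆`, for a `p`-group `A`, and lies in
`L`, centralises `A`. -/
theorem commute_of_coprime_of_commute_commutator {G : Type*} [Group G] {p : ℕ} {A : Subgroup G}
    [A.Normal] (hA : IsPGroup p A) {l a : G} (hl : p.Coprime (orderOf l)) (ha : a ∈ A)
    (h : Commute l (l * a * l⁻¹ * a⁻¹)) : Commute l a := by
  set c := l * a * l⁻¹ * a⁻¹ with hc
  have hla : l * a * l⁻¹ = c * a := by rw [hc]; group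
  have hn : ∀ n : ℕ, l ^ n * a * (l ^ n)⁻¹ = c ^ n * a := by
    intro n
    induction n with
    | zero => simp
    | succ n ih =>
      calc l ^ (n + 1) * a * (l ^ (n + 1))⁻¹ = l * (l ^ n * a * (l ^ n)⁻¹) * l⁻¹ := by
            rw [pow_succ']; group
        _ = l * c ^ n * a * l⁻¹ := by rw [ih]; group
        _ = c ^ n * (l * a * l⁻¹) := by rw [(h.pow_right n).eq]; group
        _ = _ := by rw [hla, pow_succ]; group
  have h1 : c ^ orderOf l = 1 := by
    have := hn (orderOf l)
    rw [pow_orderOf_eq_one] at this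
    simpa using this.symm
  have hcA : c ∈ A := mul_mem (Subgroup.Normal.conj_mem inferInstance a ha l) (inv_mem ha)
  have hc1 := eq_one_of_isPGroup_of_coprime hA hcA hl h1
  rw [hc1, one_mul, mul_inv_eq_iff_eq_mul] at hla
  exact hla

theorem IsPGroup.commutator_lt {G : Type*} [Group G] [Finite G] {p : ℕ} [Fact p.Prime]
    {A : Subgroup G} (hA : IsPGroup p A) (h : A ≠ ⊥) : ⁅A, A⁆ < A := by
  have : Group.IsNilpotent A := hA.isNilpotent
  have : Nontrivial A := (Subgroup.nontrivial_iff_ne_bot A).mpr h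
  have hlt := Group.IsSolvable.commutator_lt_top_of_nontrivial A
  refine lt_of_le_of_ne (Subgroup.commutator_le_self A) fun he => hlt.ne ?_
  apply Subgroup.map_injective A.subtype_injective
  rw [Subgroup.map_subtype_commutator, he, ← MonoidHom.range_eq_map, Subgroup.range_subtype]

/-- If a Sylow `p`-subgroup `P` is not normal and `O_p(G)` contains its centraliser, then `O_p(G)`
contains a normal subgroup `A` of `G` with a largest proper `G`-invariant subgroup `B`, on whose
quotient `P` acts non-trivially; moreover `B` is central in `A` and contains all commutators and
`p`-th powers of `A`. -/
theorem exists_critical_normal_subgroup {G : Type*} [Group G] [Finite G] {p : ℕ} [hp : Fact p.Prime]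
    (P : Sylow p G) (hP : ¬ (P : Subgroup G).Normal)
    (hC : Subgroup.centralizer ((P : Subgroup G).normalCore : Set G) ≤
      (P : Subgroup G).normalCore) :
    ∃ A B : Subgroup G, A.Normal ∧ B.Normal ∧ A ≤ P ∧ B < A ∧
      (∀ R : Subgroup G, R.Normal → R ≤ A → R = A ∨ R ≤ B) ∧
      (∀ b ∈ B, ∀ a ∈ A, Commute b a) ∧
      (∀ x ∈ A, ∀ a ∈ A, x * a * x⁻¹ * a⁻¹ ∈ B) ∧
      (∀ a ∈ A, a ^ p ∈ B) ∧ (∀ a ∈ A, a ^ p ^ 2 = 1) ∧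
      ¬ ∀ x ∈ P, ∀ a ∈ A, x * a * x⁻¹ * a⁻¹ ∈ B := by
  set F := (P : Subgroup G).normalCore with hF
  have hFp : IsPGroup p F := P.isPGroup'.to_le (Subgroup.normalCore_le _)
  -- L plays the role of O^p(K), where K is the normal closure of P. Working inside K ensures that
  -- anything P centralises modulo B is also centralised by L.
  set S : Set G := {g | g ∈ Subgroup.normalClosure (P : Set G) ∧ p.Coprime (orderOf g)} with hS
  set L : Subgroup G := Subgroup.normalClosure S with hL
  have hSL : S ⊆ L := Subgroup.subset_normalClosure
  have hLn : L.Normal := Subgroup.normalClosure_normal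
  -- Otherwise L ≤ C(F) ≤ F is a p-group, so K has no nontrivial p'-elements, and K = P is normal.
  have hFL : ¬ F ≤ Subgroup.centralizer (L : Set G) := by
    intro hle
    have hS1 : ∀ g ∈ S, g = 1 := by
      intro g hg
      have hgF : g ∈ F := hC (Subgroup.le_centralizer_iff.mp hle (hSL hg))
      exact eq_one_of_isPGroup_of_coprime hFp hgF hg.2 (pow_orderOf_eq_one g)
    have hK : IsPGroup p (Subgroup.normalClosure (P : Set G)) := by
      rw [isPGroup_iff_primeFactors_card_subset hp.out.ne_zero]
      intro q hq
      rw [Nat.mem_primeFactors] at hq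
      have : Fact q.Prime := ⟨hq.1⟩
      obtain ⟨g, hgK, hgq⟩ := orderOf_eq_prime_of_mem hq.2.1
      rw [hp.out.primeFactors, Finset.mem_singleton]
      by_contra hqp
      have := hS1 g ⟨hgK, by rw [hgq, Nat.coprime_primes hp.out hq.1]; exact Ne.symm hqp⟩
      rw [this, orderOf_one] at hgq
      exact hq.1.one_lt.ne hgq
    refine hP ?_
    have : (P : Subgroup G) = Subgroup.normalClosure (P : Set G) :=
      le_antisymm Subgroup.le_normalClosure (IsPGroup.le_sylow_of_normal hK P)
    rw [this]
    exact Subgroup.normalClosure_normal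
  obtain ⟨A, ⟨hAn, hAF, hAL⟩, hmin⟩ :=
    (Set.toFinite {A : Subgroup G | A.Normal ∧ A ≤ F ∧
      ¬ A ≤ Subgroup.centralizer (L : Set G)}).exists_minimal
      ⟨F, Subgroup.normalCore_normal _, le_rfl, hFL⟩
  have hCn : (Subgroup.centralizer (L : Set G)).Normal := inferInstance
  have hAp : IsPGroup p A := hFp.to_le hAF
  set B := A ⊓ Subgroup.centralizer (L : Set G) with hB
  have hBn : B.Normal := inferInstance
  have hBA : B < A := lt_of_le_of_ne inf_le_left fun h => hAL (inf_eq_left.mp h)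
  have hR : ∀ R : Subgroup G, R.Normal → R ≤ A → R = A ∨ R ≤ B := by
    intro R hRn hRA
    by_cases h : R ≤ Subgroup.centralizer (L : Set G)
    · exact .inr (le_inf hRA h)
    · exact .inl (le_antisymm hRA (hmin ⟨hRn, hRA.trans hAF, h⟩ hRA))
  have hcent : A ≤ Subgroup.centralizer S → A ≤ Subgroup.centralizer (L : Set G) := by
    intro h
    rw [Subgroup.le_centralizer_iff]
    refine Subgroup.normalClosure_le_normal ?_
    have : Subgroup.closure S ≤ Subgroup.centralizer (A : Set G) := by
      rw [← Subgroup.le_centralizer_iff, Subgroup.centralizer_closure]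
      exact h
    exact Subgroup.subset_closure.trans this
  -- If ⁅A, L⁆ ≤ B, then L centralises ⁅A, L⁆, and coprime action makes each generator in S
  -- centralise A.
  have hAeq : ⁅A, L⁆ = A := by
    refine (hR _ inferInstance (Subgroup.commutator_le_left A L)).resolve_right fun hle => ?_
    refine hAL (hcent fun a ha s hs => ?_)
    refine commute_of_coprime_of_commute_commutator hAp hs.2 ha ?_
    have hmem : s * a * s⁻¹ * a⁻¹ ∈ ⁅A, L⁆ := by
      rw [Subgroup.commutator_comm]
      exact Subgroup.commutator_mem_commutator (hSL hs) ha
    exact (hle hmem).2 s (hSL hs)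
  have hBcen : ∀ b ∈ B, ∀ a ∈ A, Commute b a := by
    -- Three subgroups lemma, with ⁅L, B⁆ = 1 and ⁅B, A⁆ ≤ C(L).
    have h1 : ⁅⁅A, L⁆, B⁆ = ⊥ := by
      apply Subgroup.commutator_commutator_eq_bot_of_rotate
      · have : ⁅L, B⁆ = ⊥ := by
          rw [Subgroup.commutator_comm, Subgroup.commutator_eq_bot_iff_le_centralizer]
          exact inf_le_right
        rw [this, Subgroup.commutator_bot_left]
      · rw [Subgroup.commutator_eq_bot_iff_le_centralizer]
        exact (Subgroup.commutator_le_left B A).trans inf_le_right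
    rw [hAeq, Subgroup.commutator_eq_bot_iff_le_centralizer] at h1
    exact fun b hb a ha => (h1 ha b hb)
  have hA1 : A ≠ ⊥ := (bot_le.trans_lt hBA).ne'
  have hAA : ⁅A, A⁆ ≤ B :=
    (hR _ inferInstance (Subgroup.commutator_le_self A)).resolve_left (hAp.commutator_lt hA1).ne
  have hcomm : ∀ x ∈ A, ∀ a ∈ A, x * a * x⁻¹ * a⁻¹ ∈ B := fun x hx a ha =>
    hAA (Subgroup.commutator_mem_commutator hx ha)
  have hmul : ∀ x ∈ A, ∀ y ∈ A, ∀ n : ℕ, ∃ k : ℕ,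
      (x * y) ^ n = x ^ n * y ^ n * (y * x * y⁻¹ * x⁻¹) ^ k := by
    intro x hx y hy n
    have hc := hcomm y hy x hx
    exact mul_pow_of_commute_commutator (by group) (hBcen _ hc _ hx) (hBcen _ hc _ hy) n
  have hpow : ∀ a ∈ A, a ^ p ∈ B := by
    -- Since A/B is abelian, the elements whose p-th power lies in B form a normal subgroup. It is
    -- not inside B because A/B is a nontrivial p-group, so it is A.
    let U : Subgroup G :=
      { carrier := {a | a ∈ A ∧ a ^ p ∈ B}
        one_mem' := ⟨A.one_mem, by rw [one_pow]; exact B.one_mem⟩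
        mul_mem' := by
          rintro x y ⟨hx, hxp⟩ ⟨hy, hyp⟩
          refine ⟨mul_mem hx hy, ?_⟩
          obtain ⟨k, hk⟩ := hmul x hx y hy p
          rw [hk]
          exact mul_mem (mul_mem hxp hyp) (pow_mem (hcomm y hy x hx) k)
        inv_mem' := by
          rintro x ⟨hx, hxp⟩
          exact ⟨inv_mem hx, by rw [inv_pow]; exact inv_mem hxp⟩ }
    have hUn : U.Normal := by
      refine ⟨fun a ha g => ⟨hAn.conj_mem a ha.1 g, ?_⟩⟩
      rw [conj_pow]
      exact hBn.conj_mem _ ha.2 g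
    rcases hR U hUn (fun a ha => ha.1) with h | h
    · intro a ha
      rw [← h] at ha
      exact ha.2
    · exfalso
      obtain ⟨a, haA, haB⟩ := SetLike.exists_of_lt hBA
      obtain ⟨n, hn⟩ := isPGroup_iff_pow_pow_eq_one.mp hAp ⟨a, haA⟩
      have hn' : a ^ p ^ n = 1 := by simpa [Subtype.ext_iff] using hn
      obtain ⟨m, hm, hmp⟩ := exists_pow_notMem_pow_mem haB (p := p) (n := n)
        (by rw [hn']; exact B.one_mem)
      exact hm (h ⟨pow_mem haA m, hmp⟩)
  have hcp : ∀ x ∈ A, ∀ a ∈ A, (x * a * x⁻¹ * a⁻¹) ^ p = 1 := by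
    intro x hx a ha
    set c := x * a * x⁻¹ * a⁻¹ with hc
    have hca : Commute c a := hBcen _ (hcomm x hx a ha) a ha
    have h1 : x * a * x⁻¹ = c * a := by rw [hc]; group
    have h2 : x * a ^ p * x⁻¹ = c ^ p * a ^ p := by rw [← conj_pow, h1, hca.mul_pow]
    rw [← (hBcen _ (hpow a ha) x hx).eq, mul_inv_cancel_right] at h2
    exact (right_eq_mul.mp h2)
  have hmul2 : ∀ x ∈ A, ∀ y ∈ A, (x * y) ^ p ^ 2 = x ^ p ^ 2 * y ^ p ^ 2 := by
    intro x hx y hy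
    obtain ⟨k, hk⟩ := hmul x hx y hy p
    have hxp := hBcen _ (hpow x hx)
    have h2 := hBcen _ (pow_mem (hcomm y hy x hx) k)
    rw [pow_two, pow_mul, hk, pow_mul x, pow_mul y]
    rw [← (h2 _ (mul_mem (pow_mem hx p) (pow_mem hy p))).eq, (h2 _
      (mul_mem (pow_mem hx p) (pow_mem hy p))).mul_pow, (hxp _ (pow_mem hy p)).mul_pow,
      ← pow_mul, mul_comm k, pow_mul, hcp y hy x hx, one_pow, one_mul]
  have hpow2 : ∀ a ∈ A, a ^ p ^ 2 = 1 := by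
    let V : Subgroup G :=
      { carrier := {a | a ∈ A ∧ a ^ p ^ 2 = 1}
        one_mem' := ⟨A.one_mem, one_pow _⟩
        mul_mem' := by
          rintro x y ⟨hx, hxp⟩ ⟨hy, hyp⟩
          exact ⟨mul_mem hx hy, by rw [hmul2 x hx y hy, hxp, hyp, one_mul]⟩
        inv_mem' := by
          rintro x ⟨hx, hxp⟩
          exact ⟨inv_mem hx, by rw [inv_pow, hxp, inv_one]⟩ }
    -- By `hmul2`, the p²-th power is multiplicative on A. It sends A into B, which L centralises,
    -- so it kills every a · (l a⁻¹ l⁻¹), and these generate A.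
    have hV : ⁅A, L⁆ ≤ V := by
      rw [Subgroup.commutator_le]
      intro a ha l hl
      have hla : l * a⁻¹ * l⁻¹ ∈ A := hAn.conj_mem _ (inv_mem ha) l
      have he : a * l * a⁻¹ * l⁻¹ = a * (l * a⁻¹ * l⁻¹) := by group
      change a * l * a⁻¹ * l⁻¹ ∈ V
      rw [he]
      refine ⟨mul_mem ha hla, ?_⟩
      have hb : a⁻¹ ^ p ^ 2 ∈ B := by
        rw [pow_two, pow_mul]
        exact pow_mem (hpow _ (inv_mem ha)) p
      have hlc : l * a⁻¹ ^ p ^ 2 = a⁻¹ ^ p ^ 2 * l := hb.2 l hl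
      rw [hmul2 a ha _ hla, conj_pow, hlc, mul_inv_cancel_right, inv_pow, mul_inv_cancel]
    intro a ha
    rw [← hAeq] at ha
    exact (hV ha).2
  refine ⟨A, B, hAn, hBn, hAF.trans (Subgroup.normalCore_le _), hBA, hR, hBcen, hcomm, hpow, hpow2,
    fun hPA => ?_⟩
  -- D is the centraliser of A/B in G. If it contained P it would contain K and L, giving A = ⁅A, L⁆
  -- ≤ B.
  let D : Subgroup G := (Subgroup.centralizer
    ((A.map (QuotientGroup.mk' B) : Subgroup (G ⧸ B)) : Set (G ⧸ B))).comap (QuotientGroup.mk' B)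
  have hmn : (A.map (QuotientGroup.mk' B)).Normal :=
    hAn.map _ (QuotientGroup.mk'_surjective B)
  have hDn : D.Normal := Subgroup.Normal.comap inferInstance _
  have hD : ∀ x, x ∈ D ↔ ∀ a ∈ A, x * a * x⁻¹ * a⁻¹ ∈ B := by
    intro x
    simp only [D, Subgroup.mem_comap, Subgroup.mem_centralizer_iff, SetLike.mem_coe,
      Subgroup.mem_map, forall_exists_index, and_imp, forall_apply_eq_imp_iff₂]
    refine forall₂_congr fun a _ => ?_
    rw [← map_mul, ← map_mul, eq_comm, QuotientGroup.mk'_apply, QuotientGroup.mk'_apply, eq_comm,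
      QuotientGroup.eq, ← hBn.mem_comm_iff]
    rw [show x * a * (a * x)⁻¹ = x * a * x⁻¹ * a⁻¹ by group]
  have hKD : Subgroup.normalClosure (P : Set G) ≤ D :=
    Subgroup.normalClosure_le_normal fun x hx => (hD x).mpr (hPA x hx)
  have hLD : L ≤ D := Subgroup.normalClosure_le_normal fun s hs => hKD hs.1
  have : ⁅A, L⁆ ≤ B := by
    rw [Subgroup.commutator_comm, Subgroup.commutator_le]
    exact fun l hl a ha => (hD l).mp (hLD hl) a ha
  rw [hAeq] at this
  exact hBA.not_ge this

/-! ### Normality of the Sylow subgroup when O_{p'}(G) = 1 -/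

/-- The consequence of the partial `Π`-property of the 2-minimal subgroups of `P` used below: for
`H = ⟨k⟩⟨y⟩` of order `p ^ 2` and each `A` with a largest proper `G`-invariant subgroup `B`, some
normal `M` with `A ∩ M = B` is such that the normaliser of `(H ∩ A M) M` has `p`-power index. -/
def HasPowIndexTraces {G : Type*} [Group G] (p : ℕ) (P : Subgroup G) : Prop :=
  ∀ k ∈ P, ∀ y ∈ P, orderOf k = p → Commute k y → y ∉ Subgroup.zpowers k →
    y ^ p ∈ Subgroup.zpowers k →
    ∀ A B : Subgroup G, A.Normal → B.Normal → B < A →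
      (∀ R : Subgroup G, R.Normal → R ≤ A → R = A ∨ R ≤ B) →
      ∃ M : Subgroup G, M.Normal ∧ A ⊓ M = B ∧
        IsPiNumber {p} (Subgroup.normalizer
          (((Subgroup.zpowers k ⊔ Subgroup.zpowers y) ⊓ (A ⊔ M) ⊔ M : Subgroup G) : Set G)).index

theorem Subgroup.conj_mem_sup_of_conj_mem {G : Type*} [Group G] {H M : Subgroup G} [M.Normal]
    {x : G} (h : ∀ a ∈ H, x * a * x⁻¹ ∈ H ⊔ M) : ∀ a ∈ H ⊔ M, x * a * x⁻¹ ∈ H ⊔ M := by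
  have hle : H ⊔ M ≤ (H ⊔ M).comap (MulAut.conj x).toMonoidHom :=
    sup_le h fun m hm => Subgroup.mem_sup_right (Subgroup.Normal.conj_mem inferInstance m hm x)
  exact fun a ha => hle ha

/-- **Dedekind's modular law** for a normal subgroup. -/
theorem Subgroup.sup_inf_assoc_of_normal {G : Type*} [Group G] {H A : Subgroup G} (M : Subgroup G)
    [M.Normal] (h : H ≤ A) : (H ⊔ M) ⊓ A = H ⊔ M ⊓ A := by
  refine le_antisymm ?_ (sup_le (le_inf le_sup_left h) (inf_le_inf_right A le_sup_right))
  rintro x ⟨hx, hxA⟩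
  obtain ⟨y, hy, m, hm, rfl⟩ := Subgroup.mem_sup_of_normal_right.mp hx
  exact Subgroup.mul_mem_sup hy ⟨hm, (A.mul_mem_cancel_left (h hy)).mp hxA⟩

theorem orderOf_pow_of_pow_sq {G : Type*} [Group G] {p : ℕ} [hp : Fact p.Prime] {a : G}
    (h1 : a ^ p ≠ 1) (h2 : a ^ p ^ 2 = 1) : orderOf (a ^ p) = p :=
  orderOf_eq_prime (by rw [← pow_mul, ← pow_two, h2]) h1

/-- The largest proper `G`-invariant subgroup `B` of the critical subgroup `A` is trivial. -/
theorem eq_bot_of_hasPowIndexTraces {G : Type*} [Group G] [Finite G] {p : ℕ} [hp : Fact p.Prime]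
    {P : Sylow p G} (hPi : HasPowIndexTraces p (P : Subgroup G)) {A B : Subgroup G}
    (hA : A.Normal) (hB : B.Normal) (hAP : A ≤ P) (hBA : B < A)
    (hR : ∀ R : Subgroup G, R.Normal → R ≤ A → R = A ∨ R ≤ B)
    (hcen : ∀ b ∈ B, ∀ a ∈ A, Commute b a) (hpow2 : ∀ a ∈ A, a ^ p ^ 2 = 1)
    (hnt : ¬ ∀ x ∈ P, ∀ a ∈ A, x * a * x⁻¹ * a⁻¹ ∈ B) : B = ⊥ := by
  by_contra hne
  obtain ⟨a, haA, haB, hap, hac⟩ := P.isPGroup'.exists_notMem_commutator_mem_of_le hAP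
    (fun x _ b hb => hB.conj_mem b hb x) (fun x _ b hb => hA.conj_mem b hb x) hBA.not_ge
  -- The subgroup k is absorbed by M, so H contributes only ⟨a⟩ to the trace. If a ^ p ≠ 1 it must
  -- serve as k, and it has order p because A has exponent dividing p².
  obtain ⟨k, hkB, hk, hak⟩ : ∃ k ∈ B, orderOf k = p ∧ a ^ p ∈ Subgroup.zpowers k := by
    by_cases h1 : a ^ p = 1
    · have hBp : IsPGroup p B := P.isPGroup'.to_le (hBA.le.trans hAP)
      have hdvd : p ∣ Nat.card B := hBp.card_eq_or_dvd.resolve_left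
        fun h => hne (Subgroup.card_eq_one.mp h)
      obtain ⟨k, hk, hkp⟩ := orderOf_eq_prime_of_mem hdvd
      exact ⟨k, hk, hkp, h1 ▸ Subgroup.one_mem _⟩
    · exact ⟨a ^ p, hap, orderOf_pow_of_pow_sq h1 (hpow2 a haA), Subgroup.mem_zpowers _⟩
  have hkle : Subgroup.zpowers k ≤ B := Subgroup.zpowers_le.mpr hkB
  obtain ⟨M, hM, hAM, hT⟩ := hPi k (hAP (hBA.le hkB)) a (hAP haA) hk (hcen k hkB a haA)
    (fun h => haB (hkle h)) hak A B hA hB hBA hR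
  have hBM : B ≤ M := hAM ▸ inf_le_right
  have hTeq : (Subgroup.zpowers k ⊔ Subgroup.zpowers a) ⊓ (A ⊔ M) ⊔ M = Subgroup.zpowers a ⊔ M := by
    have h1 : Subgroup.zpowers k ⊔ Subgroup.zpowers a ≤ A ⊔ M :=
      (sup_le (hkle.trans hBA.le) (Subgroup.zpowers_le.mpr haA)).trans le_sup_left
    rw [inf_eq_left.mpr h1, sup_comm (Subgroup.zpowers k), sup_assoc,
      sup_eq_right.mpr (hkle.trans hBM)]
  rw [hTeq] at hT
  have hTn : (Subgroup.zpowers a ⊔ M).Normal := by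
    refine Subgroup.normal_of_isPiNumber_index_normalizer P hT fun x hx => ?_
    refine Subgroup.conj_mem_sup_of_conj_mem ?_
    have hxa : x * a * x⁻¹ ∈ Subgroup.zpowers a ⊔ M := by
      have := mul_mem (Subgroup.mem_sup_right (hBM (hac x hx)))
        (Subgroup.mem_sup_left (T := M) (Subgroup.mem_zpowers a))
      rwa [inv_mul_cancel_right] at this
    intro b hb
    obtain ⟨n, rfl⟩ := Subgroup.mem_zpowers_iff.mp hb
    rw [← conj_zpow]
    exact zpow_mem hxa n
  have hle : A ≤ Subgroup.zpowers a ⊔ M := by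
    rcases hR (A ⊓ (Subgroup.zpowers a ⊔ M)) inferInstance inf_le_left with h | h
    · exact inf_eq_left.mp h
    · exact absurd (h ⟨haA, Subgroup.mem_sup_left (Subgroup.mem_zpowers a)⟩) haB
  -- P centralises ⟨a⟩M/M, which contains AM/M, so commutators of P with A fall into A ∩ M = B.
  refine hnt fun x hx c hc => ?_
  have hxM : ∀ b ∈ Subgroup.zpowers a ⊔ M, (QuotientGroup.mk' M) (x * b * x⁻¹) =
      QuotientGroup.mk' M b := by
    intro b hb
    have hle : Subgroup.zpowers a ⊔ M ≤
        ((QuotientGroup.mk' M).comp (MulAut.conj x).toMonoidHom).eqLocus (QuotientGroup.mk' M) := by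
      refine sup_le (Subgroup.zpowers_le.mpr ?_) fun m hm => ?_
      · change QuotientGroup.mk' M (x * a * x⁻¹) = QuotientGroup.mk' M a
        rw [← div_eq_one, ← map_div, ← MonoidHom.mem_ker, QuotientGroup.ker_mk', div_eq_mul_inv]
        exact hBM (hac x hx)
      · change QuotientGroup.mk' M (x * m * x⁻¹) = QuotientGroup.mk' M m
        have h1 : QuotientGroup.mk' M m = 1 := (QuotientGroup.eq_one_iff m).mpr hm
        rw [map_mul, map_mul, h1, mul_one, map_inv, mul_inv_cancel]
    exact hle hb
  have h1 := hxM c (hle hc)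
  rw [← div_eq_one, ← map_div, ← MonoidHom.mem_ker, QuotientGroup.ker_mk', div_eq_mul_inv] at h1
  rw [← hAM]
  exact ⟨A.mul_mem (hA.conj_mem c hc x) (A.inv_mem hc), h1⟩

/-- A minimal normal elementary abelian `p`-subgroup `A` on which `P` acts non-trivially contains a
maximal subgroup `⟨a⟩` of order `p`, which is the centraliser of `P` in `A`. -/
theorem exists_generators_of_hasPowIndexTraces {G : Type*} [Group G] [Finite G] {p : ℕ}
    [hp : Fact p.Prime] {P : Sylow p G} (hPi : HasPowIndexTraces p (P : Subgroup G))
    {A : Subgroup G} (hA : A.Normal) (hAP : A ≤ P) (hA1 : ⊥ < A)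
    (hR : ∀ R : Subgroup G, R.Normal → R ≤ A → R = A ∨ R ≤ ⊥)
    (hcomm : ∀ b ∈ A, ∀ a ∈ A, Commute b a) (hpow : ∀ a ∈ A, a ^ p = 1)
    (hnt : ¬ ∀ x ∈ P, ∀ a ∈ A, Commute x a) :
    ∃ a ∈ A, orderOf a = p ∧ (∀ x ∈ P, Commute x a) ∧ Subgroup.zpowers a < A ∧
      (∀ J : Subgroup G, Subgroup.zpowers a ≤ J → J ≤ A → J = Subgroup.zpowers a ∨ J = A) ∧
      ∀ c ∈ A, (∀ x ∈ P, Commute x c) → c ∈ Subgroup.zpowers a := by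
  obtain ⟨a, haA, ha1, -, hac⟩ := P.isPGroup'.exists_notMem_commutator_mem_of_le hAP
    (fun x _ b hb => (inferInstance : (⊥ : Subgroup G).Normal).conj_mem b hb x)
    (fun x _ b hb => hA.conj_mem b hb x) hA1.not_ge
  have ha1' : a ≠ 1 := fun h => ha1 (h ▸ Subgroup.one_mem _)
  have haP : ∀ x ∈ P, Commute x a := by
    intro x hx
    have := Subgroup.mem_bot.mp (hac x hx)
    rwa [mul_inv_eq_one, mul_inv_eq_iff_eq_mul] at this
  have hap : orderOf a = p := orderOf_eq_prime (hpow a haA) ha1'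
  have hZA : Subgroup.zpowers a ≤ A := Subgroup.zpowers_le.mpr haA
  have hZc : ∀ x ∈ P, ∀ c ∈ Subgroup.zpowers a, Commute x c := by
    rintro x hx c hc
    obtain ⟨n, rfl⟩ := Subgroup.mem_zpowers_iff.mp hc
    exact (haP x hx).zpow_right n
  have hZlt : Subgroup.zpowers a < A := lt_of_le_of_ne hZA fun h =>
    hnt fun x hx c hc => hZc x hx c (h ▸ hc)
  obtain ⟨b, hbA, hbZ, hbp, hbc⟩ := P.isPGroup'.exists_notMem_commutator_mem_of_le hAP
    (X := Subgroup.zpowers a)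
    (fun x hx c hc => by rw [(hZc x hx c hc).eq, mul_inv_cancel_right]; exact hc)
    (fun x _ b hb => hA.conj_mem b hb x) hZlt.not_ge
  obtain ⟨M, hM, hAM, hT⟩ := hPi a (hAP haA) b (hAP hbA) hap (hcomm a haA b hbA) hbZ hbp A ⊥ hA
    inferInstance hA1 hR
  have hHA : Subgroup.zpowers a ⊔ Subgroup.zpowers b ≤ A :=
    sup_le hZA (Subgroup.zpowers_le.mpr hbA)
  rw [inf_eq_left.mpr (hHA.trans le_sup_left)] at hT
  have hTn : (Subgroup.zpowers a ⊔ Subgroup.zpowers b ⊔ M).Normal := by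
    refine Subgroup.normal_of_isPiNumber_index_normalizer P hT fun x hx => ?_
    refine Subgroup.conj_mem_sup_of_conj_mem fun c hc => Subgroup.mem_sup_left ?_
    have hle : Subgroup.zpowers a ⊔ Subgroup.zpowers b ≤
        (Subgroup.zpowers a ⊔ Subgroup.zpowers b).comap (MulAut.conj x).toMonoidHom := by
      refine sup_le (Subgroup.zpowers_le.mpr ?_) (Subgroup.zpowers_le.mpr ?_)
      · change x * a * x⁻¹ ∈ Subgroup.zpowers a ⊔ Subgroup.zpowers b
        rw [(haP x hx).eq, mul_inv_cancel_right]
        exact Subgroup.mem_sup_left (Subgroup.mem_zpowers a)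
      · change x * b * x⁻¹ ∈ Subgroup.zpowers a ⊔ Subgroup.zpowers b
        have := mul_mem (Subgroup.mem_sup_left (T := Subgroup.zpowers b) (hbc x hx))
          (Subgroup.mem_sup_right (Subgroup.mem_zpowers b))
        rwa [inv_mul_cancel_right] at this
    exact hle hc
  have hle : A ≤ Subgroup.zpowers a ⊔ Subgroup.zpowers b ⊔ M := by
    rcases hR (A ⊓ (Subgroup.zpowers a ⊔ Subgroup.zpowers b ⊔ M)) inferInstance inf_le_left with
      h | h
    · exact inf_eq_left.mp h
    · exact absurd (h ⟨haA, Subgroup.mem_sup_left (Subgroup.mem_sup_left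
        (Subgroup.mem_zpowers a))⟩) ha1
  -- Dedekind's law: A = HM ∩ A = H(M ∩ A) = H.
  have hAeq : A = Subgroup.zpowers a ⊔ Subgroup.zpowers b := by
    refine le_antisymm ?_ hHA
    have := Subgroup.sup_inf_assoc_of_normal M hHA
    rw [inf_eq_right.mpr hle, inf_comm M A, hAM, sup_bot_eq] at this
    exact this.le
  have hJ : ∀ J : Subgroup G, Subgroup.zpowers a ≤ J → J ≤ A →
      J = Subgroup.zpowers a ∨ J = A := by
    intro J h1 h2
    rw [hAeq] at h2 ⊢
    exact eq_or_eq_of_le_sup_zpowers (hcomm a haA b hbA) hbp h1 h2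
  refine ⟨a, haA, hap, haP, hZlt, hJ, fun c hc hcP => ?_⟩
  have hCle : Subgroup.zpowers a ≤ A ⊓ Subgroup.centralizer (P : Set G) :=
    le_inf hZA fun c hc x hx => hZc x hx c hc
  have hcmem : c ∈ A ⊓ Subgroup.centralizer (P : Set G) := ⟨hc, hcP⟩
  rcases hJ _ hCle inf_le_left with h | h
  · rwa [h] at hcmem
  · exact absurd (fun x hx d hd => (inf_eq_left.mp h) hd x hx) hnt

theorem Sylow.normal_of_hasPowIndexTraces {G : Type*} [Group G] [Finite G] {p : ℕ}
    [hp : Fact p.Prime] (P : Sylow p G)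
    (hC : Subgroup.centralizer ((P : Subgroup G).normalCore : Set G) ≤
      (P : Subgroup G).normalCore)
    (hO : ∀ N : Subgroup G, N.Normal → ¬ p ∣ Nat.card N → N = ⊥)
    (hPi : HasPowIndexTraces p (P : Subgroup G)) : (P : Subgroup G).Normal := by
  by_contra hPn
  obtain ⟨A, B, hA, hB, hAP, hBA, hR, hcen, hcomm', hpow', hpow2, hnt'⟩ :=
    exists_critical_normal_subgroup P hPn hC
  obtain rfl := eq_bot_of_hasPowIndexTraces hPi hA hB hAP hBA hR hcen hpow2 hnt'
  have hiff : ∀ x a : G, x * a * x⁻¹ * a⁻¹ ∈ (⊥ : Subgroup G) ↔ Commute x a := by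
    intro x a
    rw [Subgroup.mem_bot, mul_inv_eq_one, mul_inv_eq_iff_eq_mul]
    rfl
  simp only [hiff] at hcomm' hnt'
  have hpow1 : ∀ a ∈ A, a ^ p = 1 := fun a ha => Subgroup.mem_bot.mp (hpow' a ha)
  obtain ⟨a, haA, hap, haP, hZlt, hJ, hCZ⟩ := exists_generators_of_hasPowIndexTraces hPi hA hAP hBA
    hR hcomm' hpow1 hnt'
  set Z := Subgroup.zpowers a with hZ
  have haZ : a ∈ Z := Subgroup.mem_zpowers a
  have ha1 : a ≠ 1 := by
    rintro rfl
    rw [orderOf_one] at hap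
    exact hp.out.one_lt.ne hap
  have hZc : ∀ x ∈ P, ∀ c ∈ Z, Commute x c := by
    rintro x hx c hc
    obtain ⟨n, rfl⟩ := Subgroup.mem_zpowers_iff.mp hc
    exact (haP x hx).zpow_right n
  have hmeet : ∀ M : Subgroup G, M.Normal → a ∈ M → A ≤ M := by
    intro M hM haM
    rcases hR (A ⊓ M) inferInstance inf_le_left with h | h
    · exact inf_eq_left.mp h
    · exact absurd (Subgroup.mem_bot.mp (h ⟨haA, haM⟩)) ha1
  -- the elements of order `p` in the centre of `P` lie in `Z`
  have hcenter : ∀ w ∈ P, w ^ p = 1 → (∀ x ∈ P, Commute x w) → w ∈ Z := by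
    intro w hw hwp hwP
    by_contra hwZ
    obtain ⟨M, hM, hAM, hT⟩ := hPi a (hAP haA) w hw hap (hwP a (hAP haA)) hwZ
      (hwp ▸ Subgroup.one_mem _) A ⊥ hA hB hBA hR
    -- Write an element of H ∩ AM as c m. It commutes with P, so the commutators of c with P lie in
    -- A ∩ M = 1. Hence c ∈ C_A(P) = Z.
    have hTeq : (Z ⊔ Subgroup.zpowers w) ⊓ (A ⊔ M) ⊔ M = Z ⊔ M := by
      refine le_antisymm (sup_le ?_ le_sup_right) (sup_le_sup_right
        (le_inf le_sup_left (hZlt.le.trans le_sup_left)) M)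
      rintro h ⟨hh, hhAM⟩
      obtain ⟨c, hc, m, hm, rfl⟩ := Subgroup.mem_sup_of_normal_right.mp hhAM
      refine Subgroup.mul_mem_sup (hCZ c hc fun x hx => ?_) hm
      have hle : Z ⊔ Subgroup.zpowers w ≤ Subgroup.centralizer (P : Set G) :=
        sup_le (fun c hc x hx => hZc x hx c hc) (Subgroup.zpowers_le.mpr fun x hx => hwP x hx)
      have hx1 : x * (c * m) = c * m * x := hle hh x hx
      have hx2 : c⁻¹ * (x * c * x⁻¹) = m * (x * m⁻¹ * x⁻¹) := by
        have : x * c = c * m * x * m⁻¹ := by rw [← hx1]; group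
        rw [this]; group
      have hx3 : c⁻¹ * (x * c * x⁻¹) ∈ A ⊓ M := by
        refine ⟨A.mul_mem (A.inv_mem hc) (hA.conj_mem c hc x), ?_⟩
        rw [hx2]
        exact mul_mem hm (hM.conj_mem _ (inv_mem hm) x)
      rw [hAM, Subgroup.mem_bot, inv_mul_eq_one] at hx3
      exact (mul_inv_eq_iff_eq_mul.mp hx3.symm)
    rw [hTeq] at hT
    have hTn : (Z ⊔ M).Normal := by
      refine Subgroup.normal_of_isPiNumber_index_normalizer P hT fun x hx => ?_
      refine Subgroup.conj_mem_sup_of_conj_mem fun c hc => Subgroup.mem_sup_left ?_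
      rw [(hZc x hx c hc).eq, mul_inv_cancel_right]
      exact hc
    have hle := hmeet _ hTn (Subgroup.mem_sup_left haZ)
    have := Subgroup.sup_inf_assoc_of_normal M hZlt.le
    rw [inf_eq_right.mpr hle, inf_comm M A, hAM, sup_bot_eq] at this
    exact hZlt.ne this.symm
  -- M meets P nontrivially, hence contains an element of order p central in P. That element
  -- generates Z, so a ∈ M.
  have huniq : ∀ M : Subgroup G, M.Normal → M ≠ ⊥ → A ≤ M := by
    intro M hM hM1
    have hdvd : p ∣ Nat.card M := by
      by_contra h
      exact hM1 (hO M hM h)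
    obtain ⟨g, hgM, hg⟩ := orderOf_eq_prime_of_mem hdvd
    have hgp : IsPGroup p (Subgroup.zpowers g) :=
      IsPGroup.of_card (n := 1) (by rw [Nat.card_zpowers, hg, pow_one])
    obtain ⟨Q, hQ⟩ := hgp.exists_le_sylow
    obtain ⟨x, rfl⟩ := MulAction.exists_smul_eq G P Q
    have hgP : x⁻¹ * g * x ∈ (P : Subgroup G) := by
      have := hQ (Subgroup.mem_zpowers g)
      rw [Sylow.coe_subgroup_smul, Subgroup.mem_pointwise_smul_iff_inv_smul_mem] at this
      simpa [MulAut.smul_def] using this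
    have hgM' : x⁻¹ * g * x ∈ M := by simpa using hM.conj_mem g hgM x⁻¹
    have hg1 : x⁻¹ * g * x ≠ 1 := by
      intro h
      have : g = 1 := by
        have h2 : g = x * (x⁻¹ * g * x) * x⁻¹ := by group
        rw [h2, h]; group
      rw [this, orderOf_one] at hg
      exact hp.out.one_lt.ne hg
    obtain ⟨w, ⟨hwP, hwM⟩, hw1, hwp, hwc⟩ := P.isPGroup'.exists_notMem_commutator_mem_of_le
      (X := ⊥) (Y := P ⊓ M) inf_le_left
      (fun x _ b hb => (inferInstance : (⊥ : Subgroup G).Normal).conj_mem b hb x)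
      (fun x hx b hb => ⟨P.mul_mem (P.mul_mem hx hb.1) (P.inv_mem hx), hM.conj_mem b hb.2 x⟩)
      (fun h => hg1 (Subgroup.mem_bot.mp (h ⟨hgP, hgM'⟩)))
    simp only [hiff] at hwc
    have hwZ := hcenter w hwP hwp hwc
    have hZp : Nat.card Z = p := by rw [hZ, Nat.card_zpowers, hap]
    have hwZ' : Subgroup.zpowers w = Z := by
      have hle : Subgroup.zpowers w ≤ Z := Subgroup.zpowers_le.mpr hwZ
      have hwo : orderOf w = p := orderOf_eq_prime hwp fun h => hw1 (h ▸ Subgroup.one_mem _)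
      exact Subgroup.eq_of_le_of_card_ge hle (by rw [hZp, Nat.card_zpowers, hwo])
    refine hmeet M hM ((Subgroup.zpowers_le.mpr hwM) (hwZ' ▸ haZ))
  have hPA : ¬ (P : Subgroup G) ≤ A := fun hle => hnt' fun x hx c hc => hcomm' x (hle hx) c hc
  obtain ⟨y, hyP, hyA, hyp, hyc⟩ := P.isPGroup'.exists_notMem_commutator_mem_of_le (X := A) le_rfl
    (fun x _ b hb => hA.conj_mem b hb x)
    (fun x hx b hb => mul_mem (mul_mem hx hb) (inv_mem hx)) hPA
  -- Otherwise A = ⟨Z, y ^ p⟩ commutes with y. Then (x y x⁻¹) ^ p = [x, y] ^ p y ^ p = y ^ p for x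
  -- in P, and y ^ p lies in C_A(P) = Z after all.
  have hypZ : y ^ p ∈ Z := by
    by_contra hypZ
    have hAy : A ≤ Subgroup.centralizer {y} := by
      have h1 : Z ⊔ Subgroup.zpowers (y ^ p) = A := by
        refine (hJ _ le_sup_left (sup_le hZlt.le (Subgroup.zpowers_le.mpr hyp))).resolve_left
          fun h => hypZ (h ▸ Subgroup.mem_sup_right (Subgroup.mem_zpowers _))
      rw [← h1]
      refine sup_le (fun c hc => ?_) (Subgroup.zpowers_le.mpr ?_)
      · rw [Subgroup.mem_centralizer_singleton_iff]
        exact (hZc y hyP c hc).symm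
      · rw [Subgroup.mem_centralizer_singleton_iff]
        exact (Commute.refl y).pow_left p
    refine hypZ (hCZ _ hyp fun x hx => ?_)
    have h1 : x * y ^ p * x⁻¹ = y ^ p := by
      have h2 : Commute (x * y * x⁻¹ * y⁻¹) y :=
        Subgroup.mem_centralizer_singleton_iff.mp (hAy (hyc x hx))
      rw [← conj_pow, show x * y * x⁻¹ = (x * y * x⁻¹ * y⁻¹) * y by group, h2.mul_pow,
        hpow1 _ (hyc x hx), one_mul]
    exact mul_inv_eq_iff_eq_mul.mp h1
  -- Here M = 1, as a nontrivial M would contain A. The trace is then H ∩ A, which is Z because y ∉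
  -- A.
  obtain ⟨M, hM, hAM, hT⟩ := hPi a (hAP haA) y hyP hap (haP y hyP).symm (fun h => hyA (hZlt.le h))
    hypZ A ⊥ hA hB hBA hR
  have hM1 : M = ⊥ := by
    by_contra h
    rw [inf_eq_left.mpr (huniq M hM h)] at hAM
    exact hBA.ne hAM.symm
  subst hM1
  have hTeq : (Z ⊔ Subgroup.zpowers y) ⊓ (A ⊔ ⊥) ⊔ ⊥ = Z := by
    rw [sup_bot_eq, sup_bot_eq]
    refine (eq_or_eq_of_le_sup_zpowers (haP y hyP).symm hypZ (le_inf le_sup_left hZlt.le)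
      inf_le_left).resolve_right fun h => hyA ?_
    exact inf_eq_left.mp h (Subgroup.mem_sup_right (Subgroup.mem_zpowers y))
  rw [hTeq] at hT
  have hZn : Z.Normal := Subgroup.normal_of_isPiNumber_index_normalizer P hT fun x hx c hc => by
    rw [(hZc x hx c hc).eq, mul_inv_cancel_right]
    exact hc
  exact hZlt.not_ge (hmeet Z hZn haZ)

/-! ### π-numbers, π-cores and quotients of p-soluble groups -/

theorem isPiNumber_compl_singleton_iff {p n : ℕ} (hp : p.Prime) :
    IsPiNumber {p}ᶜ n ↔ ¬ p ∣ n := by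
  refine ⟨fun h hd => h p hp hd rfl, fun h q _ hqd hqp => h ?_⟩
  rw [Set.mem_singleton_iff] at hqp
  exact hqp ▸ hqd

theorem isPiNumber_singleton_of_isPGroup {G : Type*} [Group G] [Finite G] {p : ℕ} [hp : Fact p.Prime]
    (h : IsPGroup p G) : IsPiNumber {p} (Nat.card G) := by
  intro q hq hqd
  obtain ⟨n, hn⟩ := IsPGroup.iff_card.mp h
  rw [hn] at hqd
  exact (Nat.prime_dvd_prime_iff_eq hq hp.out).mp (hq.dvd_of_dvd_pow hqd)

theorem isPGroup_of_isPiNumber_singleton {G : Type*} [Group G] [Finite G] {p : ℕ}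
    [hp : Fact p.Prime] (h : IsPiNumber {p} (Nat.card G)) : IsPGroup p G := by
  rw [isPGroup_iff_primeFactors_card_subset hp.out.ne_zero]
  intro q hq
  rw [Nat.mem_primeFactors] at hq
  rw [hp.out.primeFactors, Finset.mem_singleton]
  exact h q hq.1 hq.2.1

theorem IsPiNumber.of_dvd {π : Set ℕ} {m n : ℕ} (h : IsPiNumber π n) (hmn : m ∣ n) :
    IsPiNumber π m := fun q hq hqd => h q hq (hqd.trans hmn)

theorem IsPiNumber.mul {π : Set ℕ} {m n : ℕ} (hm : IsPiNumber π m) (hn : IsPiNumber π n) :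
    IsPiNumber π (m * n) := fun q hq hqd => (hq.dvd_mul.mp hqd).elim (hm q hq) (hn q hq)

theorem le_piCore {G : Type*} [Group G] {π : Set ℕ} {N : Subgroup G} (hN : N.Normal)
    (h : IsPiNumber π (Nat.card N)) : N ≤ piCore π G :=
  le_sSup ⟨hN, h⟩

theorem Subgroup.relIndex_mul_natCard {G : Type*} [Group G] {H K : Subgroup G} (h : H ≤ K) :
    H.relIndex K * Nat.card H = Nat.card K := by
  rw [← Subgroup.relIndex_bot_left H, ← Subgroup.relIndex_bot_left K, mul_comm,
    Subgroup.relIndex_mul_relIndex _ _ _ bot_le h]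

theorem isPiNumber_card_piCore {G : Type*} [Group G] [Finite G] (π : Set ℕ) :
    IsPiNumber π (Nat.card (piCore π G)) := by
  obtain ⟨N, ⟨hN, hNπ⟩, hmax⟩ :=
    (Set.toFinite {N : Subgroup G | N.Normal ∧ IsPiNumber π (Nat.card N)}).exists_maximal
      ⟨⊥, inferInstance, fun q hq hqd => absurd (by simpa using hqd) hq.one_lt.ne'⟩
  have : piCore π G ≤ N := by
    refine sSup_le fun M hM => ?_
    have hMn := hM.1
    refine le_sup_right.trans (hmax (y := N ⊔ M) ⟨inferInstance, ?_⟩ le_sup_left)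
    rw [← Subgroup.relIndex_mul_natCard (le_sup_left : N ≤ N ⊔ M), Subgroup.relIndex_sup_left]
    exact (hM.2.of_dvd (Subgroup.relIndex_dvd_card N M)).mul hNπ
  rw [le_antisymm this (le_piCore hN hNπ)]
  exact hNπ

theorem IsPSoluble.quotient {G : Type*} [Group G] {p : ℕ} (hG : IsPSoluble p G) (N : Subgroup G)
    [N.Normal] : IsPSoluble p (G ⧸ N) := by
  intro K L hKL
  have hs := QuotientGroup.mk'_surjective N
  have hK := hKL.normal_bot
  have hL := hKL.normal_top
  have hchief : IsChiefFactor (K.comap (QuotientGroup.mk' N)) (L.comap (QuotientGroup.mk' N)) := by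
    refine ⟨hK.comap _, hL.comap _, (Subgroup.comap_lt_comap_of_surjective hs).mpr hKL.lt, ?_⟩
    intro R hR h1 h2
    have hNR : N ≤ R := by
      refine le_trans ?_ h1
      have := Subgroup.ker_le_comap (QuotientGroup.mk' N) K
      rwa [QuotientGroup.ker_mk'] at this
    have hRR : (R.map (QuotientGroup.mk' N)).comap (QuotientGroup.mk' N) = R := by
      rw [QuotientGroup.comap_map_mk', sup_eq_right.mpr hNR]
    refine (hKL.eq_or_eq (R.map (QuotientGroup.mk' N)) (hR.map _ hs) ?_ ?_).imp
      (fun h => by rw [← h, hRR]) (fun h => by rw [← h, hRR])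
    · rwa [← Subgroup.comap_le_comap_of_surjective hs, hRR]
    · rwa [← Subgroup.comap_le_comap_of_surjective hs, hRR]
  have h := hG _ _ hchief
  rw [Subgroup.relIndex_comap] at h
  rwa [Subgroup.map_comap_eq_self_of_surjective hs] at h

theorem IsPGroup.le_normalCore_sylow {G : Type*} [Group G] [Finite G] {p : ℕ} [Fact p.Prime]
    (P : Sylow p G) {R : Subgroup G} (hR : R.Normal) (h : IsPGroup p R) :
    R ≤ (P : Subgroup G).normalCore :=
  Subgroup.normal_le_normalCore.mpr (IsPGroup.le_sylow_of_normal h P)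

/-! ### The Hall–Higman lemma -/

/-- The **Hall–Higman lemma**: in a `p`-soluble group with `O_{p'}(G) = 1`, the subgroup
`O_p(G)` contains its centraliser. -/
theorem IsPSoluble.centralizer_normalCore_le {G : Type*} [Group G] [Finite G] {p : ℕ}
    [hp : Fact p.Prime] (hG : IsPSoluble p G) (P : Sylow p G)
    (hO : ∀ N : Subgroup G, N.Normal → ¬ p ∣ Nat.card N → N = ⊥) :
    Subgroup.centralizer ((P : Subgroup G).normalCore : Set G) ≤ (P : Subgroup G).normalCore := by
  set F := (P : Subgroup G).normalCore with hF
  have hFp : IsPGroup p F := P.isPGroup'.to_le (Subgroup.normalCore_le _)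
  have hFn : F.Normal := Subgroup.normalCore_normal _
  set C := Subgroup.centralizer (F : Set G) with hC
  have hCn : C.Normal := inferInstance
  by_contra hCF
  obtain ⟨R, ⟨hRn, hFR, hRC⟩, hmin⟩ :=
    (Set.toFinite {R : Subgroup G | R.Normal ∧ F < R ∧ R ≤ F ⊔ C}).exists_minimal
      ⟨F ⊔ C, inferInstance, left_lt_sup.mpr hCF, le_rfl⟩
  have hchief : IsChiefFactor F R := by
    refine ⟨hFn, hRn, hFR, fun N hN h1 h2 => ?_⟩
    rcases h1.eq_or_lt with h | h
    · exact .inl h.symm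
    · exact .inr (le_antisymm h2 (hmin ⟨hN, h, h2.trans hRC⟩ h2))
  rcases hG F R hchief with h | h
  · have hRp : IsPGroup p R := by
      refine isPGroup_of_isPiNumber_singleton ?_
      rw [← Subgroup.relIndex_mul_natCard hFR.le]
      exact h.mul (isPiNumber_singleton_of_isPGroup hFp)
    exact hFR.not_ge (hRp.le_normalCore_sylow P hRn)
  · rw [isPiNumber_compl_singleton_iff hp.out] at h
    set D := C ⊓ R with hD
    have hDn : D.Normal := inferInstance
    have hFD : F ⊔ D = R := by
      rw [hD, ← Subgroup.sup_inf_assoc_of_normal C hFR.le, inf_eq_right.mpr hRC]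
    have hDF : ¬ D ≤ F := fun hle => by
      rw [sup_eq_left.mpr hle] at hFD
      exact hFR.ne hFD
    have hidx : ¬ p ∣ (F.subgroupOf D).index := by
      have : F.relIndex D = F.relIndex R := by rw [← hFD, Subgroup.relIndex_sup_left]
      change ¬ p ∣ F.relIndex D
      rwa [this]
    have hFDp : IsPGroup p (F.subgroupOf D) := hFp.comap_subtype
    have hcop : Nat.Coprime (Nat.card (F.subgroupOf D)) (F.subgroupOf D).index := by
      obtain ⟨n, hn⟩ := IsPGroup.iff_card.mp hFDp
      rw [hn]
      exact ((Nat.Prime.coprime_iff_not_dvd hp.out).mpr hidx).pow_left n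
    -- Schur–Zassenhaus complement to F ∩ D in D. As F ∩ D is central in D, T contains all
    -- p'-elements of D, so it is normal in G, hence trivial.
    obtain ⟨T, hT⟩ := Subgroup.exists_right_complement'_of_coprime hcop
    have hTcard : Nat.card T = (F.subgroupOf D).index := hT.symm.index_eq_card.symm
    have hTp : p.Coprime (Nat.card T) := by
      rw [hTcard]
      exact (Nat.Prime.coprime_iff_not_dvd hp.out).mpr hidx
    have hmem : ∀ x : D, p.Coprime (orderOf x) → x ∈ T := by
      intro x hx
      obtain ⟨⟨z, t⟩, hzt⟩ := hT.2 x
      change (z : D) * (t : D) = x at hzt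
      have hcomm : Commute (z : D) (t : D) :=
        Subtype.ext ((t : D).2.1 ((z : D) : G) z.2)
      have h1 : (z : D) ^ orderOf x * (t : D) ^ orderOf x = 1 := by
        rw [← hcomm.mul_pow, hzt, pow_orderOf_eq_one]
      have h2 : (z : D) ^ orderOf x = 1 := by
        have h3 : (z : D) ^ orderOf x ∈ T := by
          rw [eq_inv_of_mul_eq_one_left h1]
          exact inv_mem (pow_mem t.2 _)
        exact Subgroup.disjoint_def.mp hT.disjoint (pow_mem z.2 _) h3
      have h3 : (z : D) = 1 := eq_one_of_isPGroup_of_coprime hFDp z.2 hx h2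
      rw [← hzt, h3, one_mul]
      exact t.2
    have hTn : (T.map D.subtype).Normal := by
      refine ⟨?_⟩
      rintro _ ⟨t, ht, rfl⟩ g
      have hgD : g * D.subtype t * g⁻¹ ∈ D := hDn.conj_mem _ t.2 g
      refine ⟨⟨_, hgD⟩, hmem _ ?_, rfl⟩
      rw [Subgroup.orderOf_mk]
      have : orderOf (g * D.subtype t * g⁻¹) = orderOf t := by
        rw [← MulAut.conj_apply, MulEquiv.orderOf_eq, Subgroup.subtype_apply, Subgroup.orderOf_coe]
      rw [this]
      exact hTp.coprime_dvd_right (Subgroup.orderOf_dvd_natCard T ht)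
    have hTbot : T.map D.subtype = ⊥ := by
      refine hO _ hTn ?_
      rw [Subgroup.card_map_of_injective D.subtype_injective]
      exact (Nat.Prime.coprime_iff_not_dvd hp.out).mp hTp
    rw [Subgroup.map_eq_bot_iff_of_injective T D.subtype_injective] at hTbot
    rw [hTbot, Subgroup.card_bot, eq_comm, Subgroup.index_eq_one, Subgroup.subgroupOf_eq_top]
      at hTcard
    exact hDF hTcard

/-! ### From chief series to traces modulo a normal p'-subgroup -/

/-- Modulo a normal subgroup `N`, a chief factor of `G` becomes trivial or stays chief. -/
theorem IsChiefFactor.eq_or_eq_sup {G : Type*} [Group G] {K L N R : Subgroup G}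
    (h : IsChiefFactor K L) (hR : R.Normal) (h1 : K ⊔ N ≤ R) (h2 : R ≤ L ⊔ N) :
    R = K ⊔ N ∨ R = L ⊔ N := by
  have hL := h.normal_top
  have hNR : N ≤ R := le_sup_right.trans h1
  have hded : N ⊔ L ⊓ R = R := by
    rw [← Subgroup.sup_inf_assoc_of_normal L hNR, sup_comm, inf_eq_right.mpr h2]
  rcases h.eq_or_eq (L ⊓ R) inferInstance (le_inf h.lt.le (le_sup_left.trans h1)) inf_le_left with
    h3 | h3
  · left
    rw [← hded, h3, sup_comm]
  · right
    rw [← hded, h3, sup_comm]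

theorem comap_factorTrace {G : Type*} [Group G] {H A B : Subgroup G} [A.Normal] (hAB : A ≤ B) :
    (factorTrace H A B).comap (QuotientGroup.mk' A) = H ⊓ B ⊔ A := by
  rw [factorTrace, Subgroup.comap_inf, QuotientGroup.comap_map_mk', QuotientGroup.comap_map_mk',
    sup_eq_right.mpr hAB, sup_eq_right.mpr (le_sup_right : A ≤ H ⊔ A)]
  refine le_antisymm ?_ (sup_le (inf_le_inf_right B le_sup_left) (le_inf le_sup_right hAB))
  rintro x ⟨hx, hxB⟩
  obtain ⟨h, hh, a, ha, rfl⟩ := Subgroup.mem_sup_of_normal_right.mp hx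
  exact Subgroup.mul_mem_sup ⟨hh, (B.mul_mem_cancel_right (hAB ha)).mp hxB⟩ ha

/-- The trace is a section of the p-group H, so p is the only prime its order can have. Pulling back
along G → G/A preserves the index of the normaliser. -/
theorem isPiNumber_index_normalizer_of_factorTrace {G : Type*} [Group G] [Finite G] {p : ℕ}
    [Fact p.Prime] {H A B : Subgroup G} [A.Normal] (hH : IsPGroup p H) (hAB : A ≤ B)
    (h : IsPiNumber (groupPrimes (factorTrace H A B))
      (Subgroup.normalizer (factorTrace H A B : Set (G ⧸ A))).index) :
    IsPiNumber {p} (Subgroup.normalizer ((H ⊓ B ⊔ A : Subgroup G) : Set G)).index := by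
  rw [← comap_factorTrace hAB,
    ← Subgroup.comap_normalizer_eq_of_surjective _ (QuotientGroup.mk'_surjective A),
    Subgroup.index_comap_of_surjective _ (QuotientGroup.mk'_surjective A)]
  intro q hq hqd
  have hX : IsPGroup p (factorTrace H A B) := by
    refine (hH.map (QuotientGroup.mk' A)).to_le (inf_le_left.trans ?_)
    rw [Subgroup.map_sup, QuotientGroup.map_mk'_self, sup_bot_eq]
  exact isPiNumber_singleton_of_isPGroup hX q hq (h q hq hqd).2

/-- Modulo L, such an element is a p-element whose order divides |N|, hence trivial. -/
theorem IsPGroup.inf_sup_le_of_coprime {G : Type*} [Group G] {p : ℕ} {H N : Subgroup G}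
    (hH : IsPGroup p H) (hN : p.Coprime (Nat.card N)) [hNn : N.Normal] (L : Subgroup G) [L.Normal] :
    H ⊓ (L ⊔ N) ≤ L := by
  rintro x ⟨hxH, hx⟩
  obtain ⟨l, hl, n, hn, rfl⟩ := Subgroup.mem_sup_of_normal_right.mp hx
  have h1 : QuotientGroup.mk' L (l * n) ^ Nat.card N = 1 := by
    have hl1 : QuotientGroup.mk' L l = 1 := (QuotientGroup.eq_one_iff l).mpr hl
    rw [map_mul, hl1, one_mul, ← map_pow]
    have : n ^ Nat.card N = 1 :=
      congrArg Subtype.val (pow_card_eq_one' (x := (⟨n, hn⟩ : N)))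
    rw [this, map_one]
  have := eq_one_of_isPGroup_of_coprime (hH.map (QuotientGroup.mk' L))
    (Subgroup.mem_map_of_mem _ hxH) hN h1
  exact (QuotientGroup.eq_one_iff _).mp this

theorem PartialPiProperty.exists_normal_inf_eq {G : Type*} [Group G] [Finite G] {p : ℕ}
    [hp : Fact p.Prime] {H : Subgroup G} (hPi : PartialPiProperty H) (hH : IsPGroup p H)
    {N : Subgroup G} (hN : N.Normal) (hNp : p.Coprime (Nat.card N)) {A B : Subgroup G}
    (hA : A.Normal) (hB : B.Normal) (hNB : N ≤ B) (hBA : B < A)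
    (hR : ∀ R : Subgroup G, R.Normal → N ≤ R → R ≤ A → R = A ∨ R ≤ B) :
    ∃ M : Subgroup G, M.Normal ∧ N ≤ M ∧ A ⊓ M = B ∧
      IsPiNumber {p} (Subgroup.normalizer ((H ⊓ (A ⊔ M) ⊔ M : Subgroup G) : Set G)).index := by
  obtain ⟨s, hs0, hs1, hs⟩ := hPi
  -- The first place where the series, multiplied by N, swallows A. With K and L the two terms
  -- there, KN serves as M.
  obtain ⟨i, hi1, hi2⟩ : ∃ i : Fin s.length, ¬ A ≤ s i.castSucc ⊔ N ∧ A ≤ s i.succ ⊔ N := by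
    by_contra! hcon
    have hall : ∀ i : Fin (s.length + 1), ¬ A ≤ s i ⊔ N := by
      intro i
      induction i using Fin.induction with
      | zero =>
        intro h
        have : s 0 = ⊥ := hs0
        rw [this, bot_sup_eq] at h
        exact hBA.not_ge (h.trans hNB)
      | succ i ih => exact hcon i ih
    refine hall (Fin.last _) ?_
    have : s (Fin.last _) = ⊤ := hs1
    rw [this, top_sup_eq]
    exact le_top
  have hch : IsChiefFactor (s i.castSucc) (s i.succ) := s.step i
  have hnK : (s i.castSucc).Normal := hch.normal_bot
  have htr := isPiNumber_index_normalizer_of_factorTrace hH hch.lt.le (hs i)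
  clear hs
  generalize s i.castSucc = K at *
  generalize s i.succ = L at *
  have hL : L.Normal := hch.normal_top
  have hKL : K ⊔ N ≤ L ⊔ N := sup_le_sup_right hch.lt.le N
  have hAM : A ⊔ (K ⊔ N) = L ⊔ N := by
    refine (hch.eq_or_eq_sup inferInstance le_sup_right (sup_le hi2 hKL)).resolve_left
      fun h => hi1 ?_
    rw [← h]
    exact le_sup_left
  have hle : A ⊓ (K ⊔ N) ≤ B :=
    (hR _ inferInstance (le_inf (hNB.trans hBA.le) le_sup_right) inf_le_left).resolve_left
      fun h => hi1 (inf_eq_left.mp h)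
  -- LN/KN is chief, so otherwise B · KN = LN contains A, and Dedekind gives A = B(A ∩ KN) = B.
  have hBM : B ≤ K ⊔ N := by
    rcases hch.eq_or_eq_sup (R := B ⊔ (K ⊔ N)) inferInstance le_sup_right
      (sup_le (hBA.le.trans hi2) hKL) with h | h
    · rw [← h]
      exact le_sup_left
    · exfalso
      have h1 := Subgroup.sup_inf_assoc_of_normal (K ⊔ N) hBA.le
      rw [h, inf_eq_right.mpr hi2, inf_comm, sup_eq_left.mpr hle] at h1
      exact hBA.ne h1.symm
  refine ⟨K ⊔ N, inferInstance, le_sup_right, le_antisymm hle (le_inf hBA.le hBM), ?_⟩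
  have hHL : H ⊓ (A ⊔ (K ⊔ N)) = H ⊓ L := by
    rw [hAM]
    exact le_antisymm (le_inf inf_le_left (hH.inf_sup_le_of_coprime hNp L))
      (inf_le_inf_left H le_sup_left)
  rw [hHL, ← sup_assoc]
  refine htr.of_dvd (Subgroup.index_dvd_of_le fun x hx => ?_)
  rw [Subgroup.mem_normalizer_iff_map_conj_eq] at hx ⊢
  rw [Subgroup.map_sup, hx, Subgroup.Normal.map_conj_eq N x]

theorem isTwoMinimalIn_sup_zpowers {G : Type*} [Group G] {p : ℕ} [hp : Fact p.Prime]
    {P : Subgroup G} {k y : G} (hk : k ∈ P) (hy : y ∈ P) (hkp : orderOf k = p)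
    (hky : Commute k y) (hyk : y ∉ Subgroup.zpowers k) (hyp : y ^ p ∈ Subgroup.zpowers k) :
    IsTwoMinimalIn P (Subgroup.zpowers k ⊔ Subgroup.zpowers y) := by
  refine ⟨sup_le (Subgroup.zpowers_le.mpr hk) (Subgroup.zpowers_le.mpr hy),
    Subgroup.zpowers k, ⟨?_, ?_⟩, ⟨?_, ?_⟩⟩
  · rw [bot_lt_iff_ne_bot, Ne, Subgroup.zpowers_eq_bot, ← orderOf_eq_one_iff, hkp]
    exact hp.out.one_lt.ne'
  · intro J h1 h2
    have hcard : Nat.card (Subgroup.zpowers k) = p := by rw [Nat.card_zpowers, hkp]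
    have : Finite (Subgroup.zpowers k) := Nat.finite_of_card_ne_zero (hcard ▸ hp.out.ne_zero)
    have hd : Nat.card J ∣ p := hcard ▸ Subgroup.card_dvd_of_le h2.le
    rcases (Nat.dvd_prime hp.out).mp hd with h | h
    · exact h1.ne (Subgroup.card_eq_one.mp h).symm
    · exact h2.ne (Subgroup.eq_of_le_of_card_ge h2.le (by rw [hcard, h]))
  · exact left_lt_sup.mpr fun h => hyk (h (Subgroup.mem_zpowers y))
  · intro J h1 h2
    rcases eq_or_eq_of_le_sup_zpowers hky hyp h1.le h2.le with h | h
    · exact h1.ne h.symm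
    · exact h2.ne h

/-- P ∩ N = 1, so the quotient map is injective on P and every relation between k and y lifts. The
traces are then computed in G above N and mapped down, where the normaliser index can only be
replaced by a divisor. -/
theorem hasPowIndexTraces_map_quotient {G : Type*} [Group G] [Finite G] {p : ℕ} [hp : Fact p.Prime]
    (P : Sylow p G)
    (hP : ∀ H : Subgroup G, IsTwoMinimalIn (P : Subgroup G) H → PartialPiProperty H)
    {N : Subgroup G} [hN : N.Normal] (hNp : p.Coprime (Nat.card N)) :
    HasPowIndexTraces p ((P : Subgroup G).map (QuotientGroup.mk' N)) := by
  set φ := QuotientGroup.mk' N with hφ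
  have hs : Function.Surjective φ := QuotientGroup.mk'_surjective N
  have hNle : ∀ R : Subgroup (G ⧸ N), N ≤ R.comap φ := fun R => by
    have := Subgroup.ker_le_comap φ R
    rwa [hφ, QuotientGroup.ker_mk'] at this
  have hcm : ∀ R : Subgroup G, N ≤ R → (R.map φ).comap φ = R := fun R hR => by
    rw [hφ, QuotientGroup.comap_map_mk', sup_eq_right.mpr hR]
  have hone : ∀ x ∈ P, φ x = 1 → x = 1 := by
    intro x hx hx1
    have hxN : x ∈ N := (QuotientGroup.eq_one_iff x).mp hx1
    exact eq_one_of_isPGroup_of_coprime P.isPGroup' hx hNp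
      (congrArg Subtype.val (pow_card_eq_one' (x := (⟨x, hxN⟩ : N))))
  have hinj : ∀ x ∈ P, ∀ y ∈ P, φ x = φ y → x = y := by
    intro x hx y hy hxy
    have := hone (x * y⁻¹) (mul_mem hx (inv_mem hy)) (by rw [map_mul, hxy, map_inv, mul_inv_cancel])
    exact mul_inv_eq_one.mp this
  rintro _ ⟨k, hk, rfl⟩ _ ⟨y, hy, rfl⟩ hkp hky hyk hyp A B hA hB hBA hR
  have hk' : orderOf k = p := by
    refine orderOf_eq_prime ?_ ?_
    · refine hone _ (pow_mem hk p) ?_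
      rw [map_pow, ← hkp, pow_orderOf_eq_one]
    · rintro rfl
      rw [map_one, orderOf_one] at hkp
      exact hp.out.one_lt.ne hkp
  have hky' : Commute k y := hinj _ (mul_mem hk hy) _ (mul_mem hy hk) (by
    rw [map_mul, map_mul]; exact hky)
  have hyk' : y ∉ Subgroup.zpowers k := fun h => hyk (by
    rw [← MonoidHom.map_zpowers]
    exact Subgroup.mem_map_of_mem φ h)
  have hyp' : y ^ p ∈ Subgroup.zpowers k := by
    obtain ⟨n, hn⟩ := Subgroup.mem_zpowers_iff.mp hyp
    refine Subgroup.mem_zpowers_iff.mpr ⟨n, hinj _ (zpow_mem hk n) _ (pow_mem hy p) ?_⟩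
    rw [map_zpow, map_pow, hn]
  have h2 := isTwoMinimalIn_sup_zpowers hk hy hk' hky' hyk' hyp'
  set H := Subgroup.zpowers k ⊔ Subgroup.zpowers y with hH
  have hHmap : H.map φ = Subgroup.zpowers (φ k) ⊔ Subgroup.zpowers (φ y) := by
    rw [hH, Subgroup.map_sup, MonoidHom.map_zpowers, MonoidHom.map_zpowers]
  obtain ⟨M, hM, hNM, hAM, hT⟩ := (hP H h2).exists_normal_inf_eq (P.isPGroup'.to_le h2.1) hN hNp
    (hA.comap φ) (hB.comap φ) (hNle B) ((Subgroup.comap_lt_comap_of_surjective hs).mpr hBA)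
    (by
      intro R hRn hNR hRA
      refine (hR (R.map φ) (hRn.map φ hs) (Subgroup.map_le_iff_le_comap.mpr hRA)).imp ?_ ?_
      · intro h
        rw [← h, hcm R hNR]
      · exact Subgroup.map_le_iff_le_comap.mp)
  refine ⟨M.map φ, hM.map φ hs, ?_, ?_⟩
  · apply Subgroup.comap_injective hs
    rw [Subgroup.comap_inf, hcm M hNM, hAM]
  · rw [← hHmap]
    have hA' : (A.comap φ).map φ = A := Subgroup.map_comap_eq_self_of_surjective hs A
    have hmap : (H ⊓ (A.comap φ ⊔ M) ⊔ M).map φ = H.map φ ⊓ (A ⊔ M.map φ) ⊔ M.map φ := by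
      have hsup : (A.comap φ ⊔ M).map φ = A ⊔ M.map φ := by rw [Subgroup.map_sup, hA']
      rw [Subgroup.map_sup, ← hsup]
      congr 1
      refine le_antisymm (Subgroup.map_inf_le _ _ _) ?_
      rintro _ ⟨⟨h, hh, rfl⟩, hh2⟩
      have : h ∈ ((A.comap φ ⊔ M).map φ).comap φ := hh2
      rw [hcm _ (hNM.trans le_sup_right)] at this
      exact Subgroup.mem_map_of_mem φ ⟨hh, this⟩
    rw [← hmap]
    refine hT.of_dvd ((Subgroup.index_dvd_of_le (Subgroup.le_normalizer_map φ)).trans ?_)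
    exact Subgroup.index_map_dvd _ hs

/-! ### Reduction to G / O_{p'}(G) and conclusion -/

theorem piCore_quotient_eq_bot {G : Type*} [Group G] [Finite G] {π : Set ℕ} {N : Subgroup G}
    [hN : N.Normal] (hNπ : N = piCore π G) {R : Subgroup (G ⧸ N)} (hR : R.Normal)
    (h : IsPiNumber π (Nat.card R)) : R = ⊥ := by
  have hs : Function.Surjective (QuotientGroup.mk' N) := QuotientGroup.mk'_surjective N
  have hle : R.comap (QuotientGroup.mk' N) ≤ N := by
    have hNle : N ≤ R.comap (QuotientGroup.mk' N) := by
      have := Subgroup.ker_le_comap (QuotientGroup.mk' N) R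
      rwa [QuotientGroup.ker_mk'] at this
    have hrel : N.relIndex (R.comap (QuotientGroup.mk' N)) = Nat.card R := by
      have := Subgroup.relIndex_comap (⊥ : Subgroup (G ⧸ N)) (QuotientGroup.mk' N)
        (R.comap (QuotientGroup.mk' N))
      rwa [Subgroup.map_comap_eq_self_of_surjective hs, Subgroup.relIndex_bot_left,
        MonoidHom.comap_bot, QuotientGroup.ker_mk'] at this
    refine (le_piCore (π := π) (hR.comap _) ?_).trans hNπ.ge
    rw [← Subgroup.relIndex_mul_natCard hNle, hrel]
    exact h.mul (by rw [hNπ]; exact isPiNumber_card_piCore π)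
  rw [← Subgroup.map_comap_eq_self_of_surjective hs R, Subgroup.map_eq_bot_iff,
    QuotientGroup.ker_mk']
  exact hle

theorem theorem3p1 {G : Type*} [Group G] [Finite G] (p : ℕ) [Fact p.Prime]
    (hG : IsPSoluble p G) (P : Sylow p G)
    (hP : ∀ H : Subgroup G, IsTwoMinimalIn (P : Subgroup G) H → PartialPiProperty H) :
    pLength p G ≤ 1 := by
  have hp : p.Prime := Fact.out
  set N := piCore {p}ᶜ G with hN
  have hNn : N.Normal := piCore_normal _ _
  have hNp : p.Coprime (Nat.card N) := (Nat.Prime.coprime_iff_not_dvd hp).mpr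
    ((isPiNumber_compl_singleton_iff hp).mp (isPiNumber_card_piCore _))
  have hs : Function.Surjective (QuotientGroup.mk' N) := QuotientGroup.mk'_surjective N
  have hO : ∀ R : Subgroup (G ⧸ N), R.Normal → ¬ p ∣ Nat.card R → R = ⊥ := fun R hR h =>
    piCore_quotient_eq_bot hN hR ((isPiNumber_compl_singleton_iff hp).mpr h)
  have hnorm : ((P.mapSurjective hs : Sylow p (G ⧸ N)) : Subgroup (G ⧸ N)).Normal := by
    refine Sylow.normal_of_hasPowIndexTraces _ ((hG.quotient N).centralizer_normalCore_le _ hO) hO ?_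
    rw [Sylow.coe_mapSurjective]
    exact hasPowIndexTraces_map_quotient P hP hNp
  -- The normal Sylow subgroup of G/N lies in O_p(G/N). Hence the next quotient is a p'-group and
  -- the series ends at N₁.
  have hle : (P : Subgroup G) ≤ (piCoreAbove {p} ⟨N, hNn⟩).1 := by
    refine Subgroup.map_le_iff_le_comap.mp ?_
    rw [← Sylow.coe_mapSurjective hs]
    exact le_piCore hnorm (isPiNumber_singleton_of_isPGroup (P.mapSurjective hs).isPGroup')
  have htop : (upperPSeries p G 1).1 = ⊤ := by
    change (piCoreAbove {p}ᶜ (piCoreAbove {p} ⟨N, hNn⟩)).1 = ⊤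
    generalize piCoreAbove {p} ⟨N, hNn⟩ = U at *
    have hU := U.2
    have hidx : ¬ p ∣ U.1.index := fun h =>
      P.not_dvd_index (h.trans (Subgroup.index_dvd_of_le hle))
    have : piCore {p}ᶜ (G ⧸ U.1) = ⊤ := by
      refine top_le_iff.mp (le_piCore inferInstance ?_)
      rw [Subgroup.card_top, isPiNumber_compl_singleton_iff hp]
      exact hidx
    change (piCore {p}ᶜ (G ⧸ U.1)).comap _ = ⊤
    rw [this, Subgroup.comap_top]
  exact (iInf₂_le 1 htop).trans (by simp)
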